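/- **Weighted polar decomposition of a simple polytope.** Let $\Delta=H_1\cap\dots\cap H_d\subset\mathbb R^n$ be a compact convex polytope, written as an intersection of closed half-spaces $H_i=\{x: \langle u_i,x\rangle\le c_i\}$ ($u_i\in(\mathbb R^n)^*$, $u_i\neq 0$) with $d$ as small as possible, and let $\sigma_i=\Delta\cap\partial H_i$ be its facets. For a vertex $v$ of $\Delta$ put $I_v=\{i : v\in\sigma_i\}$. Assume that $\Delta$ is simple, i.e. $|I_v|=n$ for every vertex $v$. For each vertex $v$ and each $i\in I_v$ let $\alpha_{i,v}\neq 0$ be any vector pointing from $v$ in the direction of the (unique) edge of $\Delta$ at $v$ that is not contained in $\sigma_i$. Let $\xi\in(\mathbb R^n)^*$ be a polarizing vector, that is, $\langle\xi,\alpha_{i,v}\rangle\ne 0$ for all vertices $v$ and all $i\in I_v$. Define the polarized edge vectors by $$\alpha_{i,v}^\sharp=\begin{cases}\alpha_{i,v}&\text{if }\langle\xi,\alpha_{i,v}\rangle<0,\\-\alpha_{i,v}&\text{if }\langle\xi,\alpha_{i,v}\rangle>0,\end{cases}$$ the polarized tangent cones by $$\mathbf C_v^\sharp=v+\sum_{i\in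 I_v}\mathbb R_{\ge0}\,\alpha_{i,v}^\sharp ,$$ and let $\#v$ be the number of $i\in I_v$ with $\langle\xi,\alpha_{i,v}\rangle>0$, i.e. the number of edge vectors at $v$ that are flipped. For a polytope or polyhedral cone $P\subset\mathbb R^n$ let $\mathbf 1^w_P:\mathbb R^n\to\mathbb R$ be the weighted characteristic function, which is $0$ outside $P$ and takes the value $1/2^k$ on the relative interior of each face of $P$ of codimension $k$ in $\mathbb R^n$ (in particular, the value $1$ on the interior of $P$). Then for every $x\in\mathbb R^n$, $$\mathbf 1^w_\Delta(x)=\sum_{v}(-1)^{\#v}\,\mathbf 1^w_{\mathbf C_v^\sharp}(x),$$ where the sum is over the vertices $v$ of $\Delta$. -/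

import Mathlib

open scoped BigOperators

noncomputable section

namespace PolarDecomposition

/-! ### Faces and weighted characteristic functions of convex sets -/

section Weighted

variable {E : Type*} [NormedAddCommGroup E] [NormedSpace ℝ E]

/-- `F` is a (nonempty) face of `P`: the set of points of `P` where some linear functional attains
its maximum over `P`.  The zero functional shows that a nonempty `P` is a face of itself. -/
def IsFace (P F : Set E) : Prop :=
  IsExposed ℝ P F ∧ F.Nonempty

/-- The dimension of a face: the dimension of its affine span. -/
def faceDim (F : Set E) : ℕ :=
  Module.finrank ℝ (vectorSpan ℝ F)

/-- The codimension of a face in the ambient space. -/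
def faceCodim (F : Set E) : ℕ :=
  Module.finrank ℝ E - faceDim F

/-- An edge of `P` is a one-dimensional face. -/
def IsEdge (P e : Set E) : Prop :=
  IsFace P e ∧ faceDim e = 1

open Classical in
/-- The weighted characteristic function of a polyhedron `P`: it takes the value `1 / 2 ^ k` on the
relative interior of each codimension `k` face of `P`, and `0` outside of `P`.  The choice of the
face is immaterial, see `weightedIndicator_eq`. -/
def weightedIndicator (P : Set E) (x : E) : ℝ :=
  if h : ∃ F : Set E, IsFace P F ∧ x ∈ intrinsicInterior ℝ F then
    1 / 2 ^ faceCodim h.choose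
  else 0

/-- A segment in `F` ending at a relative interior point of `F` can be prolonged inside `F`. -/
theorem exists_prolong {F : Set E} {x y : E} (hx : x ∈ intrinsicInterior ℝ F) (hy : y ∈ F) :
    ∃ t : ℝ, 0 < t ∧ x + t • (x - y) ∈ F := by
  obtain ⟨z, hz, rfl⟩ := mem_intrinsicInterior.1 hx
  have hy' : y ∈ affineSpan ℝ F := subset_affineSpan ℝ F hy
  have hmem : ∀ t : ℝ, (z : E) + t • ((z : E) - y) ∈ affineSpan ℝ F := by
    intro t
    have h := AffineMap.lineMap_mem (-t) z.2 hy'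
    have e : AffineMap.lineMap (z : E) y (-t) = (z : E) + t • ((z : E) - y) := by
      rw [AffineMap.lineMap_apply, vsub_eq_sub, vadd_eq_add]
      module
    rwa [e] at h
  let g : ℝ → affineSpan ℝ F := fun t => ⟨(z : E) + t • ((z : E) - y), hmem t⟩
  have hg : Continuous g := by
    apply Continuous.subtype_mk
    fun_prop
  have hg0 : g 0 = z := by
    apply Subtype.ext
    simp [g]
  have hev : ∀ᶠ t in nhds (0 : ℝ), g t ∈ interior ((↑) ⁻¹' F : Set (affineSpan ℝ F)) := by
    apply hg.continuousAt.eventually_mem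
    rw [hg0]
    exact isOpen_interior.mem_nhds hz
  have hev' : ∀ᶠ t in nhdsWithin (0 : ℝ) (Set.Ioi 0),
      g t ∈ interior ((↑) ⁻¹' F : Set (affineSpan ℝ F)) :=
    hev.filter_mono nhdsWithin_le_nhds
  obtain ⟨t, ht, ht0⟩ := (hev'.and self_mem_nhdsWithin).exists
  have hmemF : g t ∈ ((↑) ⁻¹' F : Set (affineSpan ℝ F)) := interior_subset ht
  exact ⟨t, ht0, hmemF⟩

/-- A face that meets the relative interior of a face `F` contains `F`. -/
theorem IsFace.subset_of_mem {P F G : Set E} {x : E} (hF : IsFace P F) (hG : IsFace P G)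
    (hx : x ∈ intrinsicInterior ℝ F) (hxG : x ∈ G) : F ⊆ G := by
  obtain ⟨l, hl⟩ := hG.1 hG.2
  intro y hy
  obtain ⟨t, ht, hmem⟩ := exists_prolong hx hy
  have hFP : F ⊆ P := hF.1.subset
  rw [hl] at hxG ⊢
  have h1 := hxG.2 _ (hFP hmem)
  simp only [map_add, map_smul, map_sub, smul_eq_mul] at h1
  have h2 : l x ≤ l y := by
    by_contra hlt
    push Not at hlt
    nlinarith [mul_pos ht (sub_pos.2 hlt)]
  exact ⟨hFP hy, fun w hw => (hxG.2 w hw).trans h2⟩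

theorem weightedIndicator_eq {P F : Set E} {x : E} (hF : IsFace P F)
    (hx : x ∈ intrinsicInterior ℝ F) : weightedIndicator P x = 1 / 2 ^ faceCodim F := by
  have h : ∃ F : Set E, IsFace P F ∧ x ∈ intrinsicInterior ℝ F := ⟨F, hF, hx⟩
  have hc := h.choose_spec
  have e : h.choose = F :=
    Set.Subset.antisymm
      (hc.1.subset_of_mem hF hc.2 (intrinsicInterior_subset hx))
      (hF.subset_of_mem hc.1 hx (intrinsicInterior_subset hc.2))
  rw [weightedIndicator, dif_pos h, e]

theorem weightedIndicator_eq_zero {P : Set E} {x : E} (hx : x ∉ P) :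
    weightedIndicator P x = 0 := by
  rw [weightedIndicator, dif_neg]
  rintro ⟨F, hF, hxF⟩
  exact hx (hF.1.subset (intrinsicInterior_subset hxF))

end Weighted

/-! ### Polytopes given by half-spaces -/

section Polytope

variable {n d : ℕ}

/-- The intersection of the `d` half-spaces `{x | ⟨u i, x⟩ ≤ c i}` in `ℝⁿ`. -/
def polyhedron (u : Fin d → StrongDual ℝ (EuclideanSpace ℝ (Fin n))) (c : Fin d → ℝ) :
    Set (EuclideanSpace ℝ (Fin n)) :=
  {x | ∀ i, u i x ≤ c i}

/-- The intersection of the polyhedron with the boundary hyperplane of the `i`-th half-space.  These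
are the facets when the description by half-spaces is a shortest one. -/
def facet (u : Fin d → StrongDual ℝ (EuclideanSpace ℝ (Fin n))) (c : Fin d → ℝ) (i : Fin d) :
    Set (EuclideanSpace ℝ (Fin n)) :=
  polyhedron u c ∩ {x | u i x = c i}

open Classical in
/-- The set `I_v` of (indices of) the facets that contain `v`. -/
def facetsAt (u : Fin d → StrongDual ℝ (EuclideanSpace ℝ (Fin n))) (c : Fin d → ℝ)
    (v : EuclideanSpace ℝ (Fin n)) : Finset (Fin d) :=
  Finset.univ.filter fun i => v ∈ facet u c i

theorem mem_facetsAt {u : Fin d → StrongDual ℝ (EuclideanSpace ℝ (Fin n))} {c : Fin d → ℝ}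
    {v : EuclideanSpace ℝ (Fin n)} {i : Fin d} : i ∈ facetsAt u c v ↔ v ∈ facet u c i := by
  simp [facetsAt]

/-- An extreme point of a polyhedron is determined by the facets through it. -/
theorem eq_of_facetsAt_eq {u : Fin d → StrongDual ℝ (EuclideanSpace ℝ (Fin n))} {c : Fin d → ℝ}
    {v w : EuclideanSpace ℝ (Fin n)} (hv : v ∈ (polyhedron u c).extremePoints ℝ)
    (hw : w ∈ polyhedron u c) (h : facetsAt u c v = facetsAt u c w) : v = w := by
  have key : ∀ i, ∀ᶠ t in nhdsWithin (0 : ℝ) (Set.Ioi 0), u i (v + t • (v - w)) ≤ c i := by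
    intro i
    by_cases hi : u i v = c i
    · have hwi : u i w = c i := by
        have : i ∈ facetsAt u c v := by
          simp [facetsAt, facet, hi, hv.1]
        rw [h] at this
        exact (mem_facetsAt.1 this).2
      refine Filter.Eventually.of_forall fun t => ?_
      simp [hi, hwi]
    · have hlt : u i v < c i := lt_of_le_of_ne (hv.1 i) hi
      have hc : Continuous fun t : ℝ => u i (v + t • (v - w)) := by fun_prop
      have h0 : (fun t : ℝ => u i (v + t • (v - w))) 0 < c i := by simpa using hlt
      exact ((hc.continuousAt.eventually_lt_const h0).mono fun t ht => ht.le).filter_mono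
        nhdsWithin_le_nhds
  obtain ⟨t, ht, ht0⟩ := ((Filter.eventually_all.2 key).and self_mem_nhdsWithin).exists
  have ht0' : (0 : ℝ) < t := ht0
  have hp : v + t • (v - w) ∈ polyhedron u c := ht
  have hopen : v ∈ openSegment ℝ w (v + t • (v - w)) := by
    refine ⟨t / (1 + t), 1 / (1 + t), by positivity, by positivity, by field_simp; ring, ?_⟩
    have h1 : (1 : ℝ) + t ≠ 0 := by positivity
    have e : (t / (1 + t)) • w + (1 / (1 + t)) • (v + t • (v - w))
        = ((1 + t) / (1 + t)) • v := by
      module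
    rw [e, div_self h1, one_smul]
  exact (hv.2 hw hp hopen).symm

theorem finite_extremePoints (u : Fin d → StrongDual ℝ (EuclideanSpace ℝ (Fin n)))
    (c : Fin d → ℝ) : ((polyhedron u c).extremePoints ℝ).Finite := by
  refine Set.Finite.of_finite_image (f := facetsAt u c) (Set.toFinite _) ?_
  intro v hv w hw h
  exact eq_of_facetsAt_eq hv hw.1 h

/-- The vertices of the polyhedron, that is, its extreme points. -/
def vertices (u : Fin d → StrongDual ℝ (EuclideanSpace ℝ (Fin n))) (c : Fin d → ℝ) :
    Finset (EuclideanSpace ℝ (Fin n)) :=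
  (finite_extremePoints u c).toFinset

/-- The data `u, c` present the set `polyhedron u c` as a compact intersection of `d` half-spaces,
`d` being the smallest possible number of half-spaces for this set, and each vertex lies on
exactly `n` facets. -/
structure IsSimplePolytope (u : Fin d → StrongDual ℝ (EuclideanSpace ℝ (Fin n)))
    (c : Fin d → ℝ) : Prop where
  isCompact : IsCompact (polyhedron u c)
  ne_zero : ∀ i, u i ≠ 0
  minimal : ∀ (d' : ℕ) (u' : Fin d' → StrongDual ℝ (EuclideanSpace ℝ (Fin n)))
    (c' : Fin d' → ℝ), (∀ i, u' i ≠ 0) → polyhedron u' c' = polyhedron u c → d ≤ d'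
  simple : ∀ v ∈ vertices u c, (facetsAt u c v).card = n

/-- `a` is a nonzero vector pointing from `v` along an edge at `v` that does not belong to the
facet `i`. -/
def IsEdgeVector (u : Fin d → StrongDual ℝ (EuclideanSpace ℝ (Fin n))) (c : Fin d → ℝ)
    (v : EuclideanSpace ℝ (Fin n)) (i : Fin d) (a : EuclideanSpace ℝ (Fin n)) : Prop :=
  a ≠ 0 ∧ ∃ e : Set (EuclideanSpace ℝ (Fin n)), IsEdge (polyhedron u c) e ∧ v ∈ e ∧
    ¬ e ⊆ facet u c i ∧ ∃ t : ℝ, 0 < t ∧ v + t • a ∈ e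

/-- The polarized vector: `a` is flipped if it pairs positively with `ξ`. -/
def polarize (ξ : StrongDual ℝ (EuclideanSpace ℝ (Fin n))) (a : EuclideanSpace ℝ (Fin n)) :
    EuclideanSpace ℝ (Fin n) :=
  if 0 < ξ a then -a else a

/-- The cone `v + ∑_{i ∈ I} ℝ_{≥ 0} a i`. -/
def coneAt (v : EuclideanSpace ℝ (Fin n)) (I : Finset (Fin d))
    (a : Fin d → EuclideanSpace ℝ (Fin n)) : Set (EuclideanSpace ℝ (Fin n)) :=
  {x | ∃ r : Fin d → ℝ, (∀ i, 0 ≤ r i) ∧ x = v + ∑ i ∈ I, r i • a i}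

/-- The polarized tangent cone at `v`, for edge vectors `a i`, `i ∈ I_v`. -/
def polarizedCone (u : Fin d → StrongDual ℝ (EuclideanSpace ℝ (Fin n))) (c : Fin d → ℝ)
    (ξ : StrongDual ℝ (EuclideanSpace ℝ (Fin n))) (v : EuclideanSpace ℝ (Fin n))
    (a : Fin d → EuclideanSpace ℝ (Fin n)) : Set (EuclideanSpace ℝ (Fin n)) :=
  coneAt v (facetsAt u c v) fun i => polarize ξ (a i)

/-- The number of edge vectors `a i`, `i ∈ I_v`, that are flipped. -/
def numFlipped (u : Fin d → StrongDual ℝ (EuclideanSpace ℝ (Fin n))) (c : Fin d → ℝ)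
    (ξ : StrongDual ℝ (EuclideanSpace ℝ (Fin n))) (v : EuclideanSpace ℝ (Fin n))
    (a : Fin d → EuclideanSpace ℝ (Fin n)) : ℕ :=
  ((facetsAt u c v).filter fun i => 0 < ξ (a i)).card

end Polytope

end PolarDecomposition

end

/-! ### Step functions with half values -/

noncomputable section

namespace PolarDecomposition

/-! With `h i` the half-valued step function of `c i - u i x`, simplicity turns the left side into
`∏ i, h i`, one factor `1 / 2` per tight facet. At a vertex `v`, an unflipped edge vector gives the
factor `h i`; a flipped one gives `1 - h i` and a sign, hence `h i - 1`. So the claim is that `∏ i,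
h i` equals the sum over `v` of `∏ i ∈ I_v, (h i - f v i)`, where `f` indicates flips.

This is proved for every face at once. For a set `J` of facets and `x` on all their hyperplanes,
keep only vertices with `J ⊆ I_v` and factors outside `J`; `defect` is the difference of the two
sides. It is affine in each `h i`, with slope the defect of `insert i J` (`defect_update`). By
induction this slope vanishes when `x` lies on hyperplane `i`, so the values of the weights on
hyperplanes through `x` are irrelevant (`IsWeightAt.defect_eq`). The defect therefore does not jump
when `x` crosses a hyperplane, and it is constant along lines inside the affine space cut out by
`J`. Far out in a direction of increasing `ξ` everything vanishes: `x` has left the polytope, and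
`ξ` attains its maximum on each polarized cone at the apex (`apply_le_of_prod_ne_zero`). -/

/-- The step function with value `1 / 2` at the jump. -/
def halfStep (s : ℝ) : ℝ :=
  if s < 0 then 0 else if s = 0 then 1 / 2 else 1

theorem halfStep_of_neg {s : ℝ} (h : s < 0) : halfStep s = 0 := by
  simp [halfStep, h]

theorem halfStep_of_pos {s : ℝ} (h : 0 < s) : halfStep s = 1 := by
  simp [halfStep, h.not_gt, h.ne']

@[simp]
theorem halfStep_zero : halfStep 0 = 1 / 2 := by
  simp [halfStep]

/-- The value `1 / 2` at the jump makes this hold at `0` too; reversing an edge vector thus replaces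
a weight by its complement. -/
theorem halfStep_neg (s : ℝ) : halfStep (-s) = 1 - halfStep s := by
  rcases lt_trichotomy s 0 with h | rfl | h
  · rw [halfStep_of_neg h, halfStep_of_pos (by linarith)]; norm_num
  · norm_num
  · rw [halfStep_of_pos h, halfStep_of_neg (by linarith)]; norm_num

theorem halfStep_mul_of_pos {r : ℝ} (hr : 0 < r) (s : ℝ) : halfStep (r * s) = halfStep s := by
  rcases lt_trichotomy s 0 with h | rfl | h
  · rw [halfStep_of_neg h, halfStep_of_neg (mul_neg_of_pos_of_neg hr h)]
  · simp
  · rw [halfStep_of_pos h, halfStep_of_pos (mul_pos hr h)]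

/-! ### Weighted indicators as products over half-spaces -/

section Weighted

variable {E : Type*} [NormedAddCommGroup E] [NormedSpace ℝ E] [FiniteDimensional ℝ E]

/-- The common kernel of a finite family of functionals that has a dual family. -/
theorem finrank_iInf_ker {ι : Type*} [Fintype ι] [DecidableEq ι] (w : ι → StrongDual ℝ E)
    (β : ι → E) (hβ : ∀ i j, w i (β j) = if i = j then 1 else 0) :
    Module.finrank ℝ (LinearMap.ker (LinearMap.pi fun i => (w i : E →ₗ[ℝ] ℝ))) + Fintype.card ι
      = Module.finrank ℝ E := by
  have hs : Function.Surjective (LinearMap.pi fun i => (w i : E →ₗ[ℝ] ℝ)) := by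
    intro r
    refine ⟨∑ j, r j • β j, ?_⟩
    ext i
    simp [hβ]
  have h := LinearMap.finrank_range_add_finrank_ker (LinearMap.pi fun i => (w i : E →ₗ[ℝ] ℝ))
  rw [LinearMap.range_eq_top.2 hs, finrank_top, Module.finrank_fintype_fun_eq_card] at h
  omega

/-- A set that agrees near `x` with a simplicial cone with apex space through `x`. -/
theorem weightedIndicator_of_local {ι : Type*} [Fintype ι] [DecidableEq ι] {P : Set E} {x : E}
    (w : ι → StrongDual ℝ E) (β : ι → E) (hβ : ∀ i j, w i (β j) = if i = j then 1 else 0)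
    (hP : ∀ y ∈ P, ∀ i, w i y ≤ w i x)
    (hloc : ∀ᶠ y in nhds x, (∀ i, w i y ≤ w i x) → y ∈ P) :
    weightedIndicator P x = 1 / 2 ^ Fintype.card ι := by
  have hxP : x ∈ P := hloc.self_of_nhds fun i => le_rfl
  let F : Set E := {y | y ∈ P ∧ ∀ i, w i y = w i x}
  have hxF : x ∈ F := ⟨hxP, fun _ => rfl⟩
  have hface : IsFace P F := by
    -- On `P` every `w i` is at most `w i x`, so the sum is maximal exactly where all of them are
    -- attained.
    refine ⟨fun _ => ⟨∑ i, w i, ?_⟩, ⟨x, hxF⟩⟩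
    ext y
    constructor
    · rintro ⟨hy, hyx⟩
      refine ⟨hy, fun z hz => ?_⟩
      simp only [sum_apply]
      exact Finset.sum_le_sum fun i _ => (hP z hz i).trans (hyx i).ge
    · rintro ⟨hy, hyx⟩
      refine ⟨hy, fun i => ?_⟩
      have h1 := hyx x hxP
      simp only [sum_apply] at h1
      exact (Finset.sum_eq_sum_iff_of_le fun i _ => hP y hy i).1
        (le_antisymm (Finset.sum_le_sum fun i _ => hP y hy i) h1) i (Finset.mem_univ i)
  have hlocF : ∀ᶠ y in nhds x, (∀ i, w i y = w i x) → y ∈ F :=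
    hloc.mono fun y hy h => ⟨hy fun i => (h i).le, h⟩
  have hspan : vectorSpan ℝ F = LinearMap.ker (LinearMap.pi fun i => (w i : E →ₗ[ℝ] ℝ)) := by
    apply le_antisymm
    · rw [vectorSpan_def, Submodule.span_le]
      rintro _ ⟨y, hy, z, hz, rfl⟩
      simp only [SetLike.mem_coe, LinearMap.mem_ker]
      ext i
      simp [hy.2 i, hz.2 i]
    · intro z hz
      have hz' : ∀ i, w i z = 0 := fun i => congrFun (LinearMap.mem_ker.1 hz) i
      have hc : Continuous fun t : ℝ => x + t • z := by fun_prop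
      have hev : ∀ᶠ t in nhds (0 : ℝ), (∀ i, w i (x + t • z) = w i x) → x + t • z ∈ F := by
        have htend : Filter.Tendsto (fun t : ℝ => x + t • z) (nhds 0) (nhds x) := by
          simpa using hc.tendsto 0
        exact htend.eventually hlocF
      have hev' : ∀ᶠ t in nhdsWithin (0 : ℝ) (Set.Ioi 0),
          (∀ i, w i (x + t • z) = w i x) → x + t • z ∈ F := hev.filter_mono nhdsWithin_le_nhds
      obtain ⟨t, ht, ht0⟩ := (hev'.and self_mem_nhdsWithin).exists
      have ht0' : (0 : ℝ) < t := ht0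
      have hmem := ht fun i => by simp [hz' i]
      have := vsub_mem_vectorSpan ℝ hmem hxF
      have h2 := (vectorSpan ℝ F).smul_mem t⁻¹ this
      simpa [smul_smul, inv_mul_cancel₀ ht0'.ne'] using h2
  -- The affine span of `F` is `x` plus the common kernel, so near `x` its points satisfy every
  -- constraint with equality and lie in `F`.
  have hint : x ∈ intrinsicInterior ℝ F := by
    refine mem_intrinsicInterior.2 ⟨⟨x, subset_affineSpan ℝ F hxF⟩, ?_, rfl⟩
    rw [mem_interior_iff_mem_nhds]
    have hcont : ContinuousAt ((↑) : affineSpan ℝ F → E) ⟨x, subset_affineSpan ℝ F hxF⟩ :=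
      continuous_subtype_val.continuousAt
    have := hcont.eventually hlocF
    filter_upwards [this] with y hy
    apply hy
    intro i
    have h1 := AffineSubspace.vsub_mem_direction y.2 (subset_affineSpan ℝ F hxF)
    rw [direction_affineSpan, hspan] at h1
    have h2 := congrFun (LinearMap.mem_ker.1 h1) i
    simpa [sub_eq_zero] using h2
  rw [weightedIndicator_eq hface hint, faceCodim, faceDim, hspan]
  have := finrank_iInf_ker w β hβ
  congr 2
  omega

/-- The weighted characteristic function of an intersection of half-spaces, the tight ones of which
are independent at each point. -/
theorem weightedIndicator_eq_prod {ι : Type*} [Fintype ι] [DecidableEq ι]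
    (w : ι → StrongDual ℝ E) (b : ι → ℝ) (x : E)
    (hβ : (∀ i, w i x ≤ b i) →
      ∃ β : ι → E, ∀ i j, w i x = b i → w j x = b j → w i (β j) = if i = j then 1 else 0) :
    weightedIndicator {y | ∀ i, w i y ≤ b i} x = ∏ i, halfStep (b i - w i x) := by
  by_cases hx : ∀ i, w i x ≤ b i
  · obtain ⟨β, hβ⟩ := hβ hx
    -- Only the constraints tight at `x` matter locally; their number is the codimension, and each
    -- contributes a factor `1 / 2`.
    rw [weightedIndicator_of_local (ι := {i // w i x = b i}) (fun i => w i) (fun i => β i)]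
    · rw [Fintype.card_subtype, ← Finset.prod_filter_mul_prod_filter_not Finset.univ
        (fun i => w i x = b i)]
      rw [Finset.prod_congr rfl (g := fun _ => (1 / 2 : ℝ)), Finset.prod_const,
        Finset.prod_congr rfl (g := fun _ => (1 : ℝ)), Finset.prod_const_one]
      · simp
      · intro i hi
        exact halfStep_of_pos (sub_pos.2 (lt_of_le_of_ne (hx i) (Finset.mem_filter.1 hi).2))
      · intro i hi
        rw [(Finset.mem_filter.1 hi).2, sub_self, halfStep_zero]
    · rintro ⟨i, hi⟩ ⟨j, hj⟩
      simpa using hβ i j hi hj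
    · rintro y hy ⟨i, hi⟩
      exact (hy i).trans hi.ge
    · have : ∀ᶠ y in nhds x, ∀ i, w i x < b i → w i y < b i := by
        refine Filter.eventually_all.2 fun i => ?_
        by_cases hi : w i x < b i
        · exact ((w i).continuous.continuousAt.eventually_lt_const hi).mono fun y hy _ => hy
        · exact Filter.Eventually.of_forall fun y h => absurd h hi
      filter_upwards [this] with y hy h i
      rcases (hx i).lt_or_eq with hi | hi
      · exact (hy i hi).le
      · exact (h ⟨i, hi⟩).trans hi.le
  · rw [weightedIndicator_eq_zero (P := {y | ∀ i, w i y ≤ b i}) hx]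
    push Not at hx
    obtain ⟨i, hi⟩ := hx
    exact (Finset.prod_eq_zero (Finset.mem_univ i) (halfStep_of_neg (sub_neg.2 hi))).symm

end Weighted

/-! ### Vertices, tight facets and edges -/

section Polytope

variable {n d : ℕ} {u : Fin d → StrongDual ℝ (EuclideanSpace ℝ (Fin n))} {c : Fin d → ℝ}
  {v x z : EuclideanSpace ℝ (Fin n)}

theorem mem_vertices : v ∈ vertices u c ↔ v ∈ (polyhedron u c).extremePoints ℝ := by
  simp [vertices]

theorem mem_polyhedron_of_mem_vertices (hv : v ∈ vertices u c) : v ∈ polyhedron u c :=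
  (mem_vertices.1 hv).1

theorem apply_eq_of_mem_facetsAt {i : Fin d} (hi : i ∈ facetsAt u c v) : u i v = c i :=
  (mem_facetsAt.1 hi).2

theorem mem_facetsAt_iff (hv : v ∈ polyhedron u c) {i : Fin d} :
    i ∈ facetsAt u c v ↔ u i v = c i := by
  simp [mem_facetsAt, facet, hv]

/-- Small steps from `v` that do not leave the half-spaces tight at `v` stay in the polyhedron, and
are strictly inside the other half-spaces. -/
theorem eventually_lt_of_notMem_facetsAt (hv : v ∈ polyhedron u c)
    (z : EuclideanSpace ℝ (Fin n)) :
    ∀ᶠ t in nhdsWithin (0 : ℝ) (Set.Ioi 0), ∀ i, i ∉ facetsAt u c v → u i (v + t • z) < c i := by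
  refine Filter.eventually_all.2 fun i => ?_
  by_cases hi : i ∈ facetsAt u c v
  · exact Filter.Eventually.of_forall fun t h => absurd hi h
  · rw [mem_facetsAt_iff hv] at hi
    have hlt : u i v < c i := lt_of_le_of_ne (hv i) hi
    have hc : Continuous fun t : ℝ => u i (v + t • z) := by fun_prop
    have h0 : (fun t : ℝ => u i (v + t • z)) 0 < c i := by simpa using hlt
    exact ((hc.continuousAt.eventually_lt_const h0).mono fun t ht _ => ht).filter_mono
      nhdsWithin_le_nhds

theorem exists_step_mem (hv : v ∈ polyhedron u c) (hz : ∀ i ∈ facetsAt u c v, u i z ≤ 0) :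
    ∃ t : ℝ, 0 < t ∧ v + t • z ∈ polyhedron u c ∧
      ∀ i, i ∉ facetsAt u c v → u i (v + t • z) < c i := by
  obtain ⟨t, ht, ht0⟩ := ((eventually_lt_of_notMem_facetsAt hv z).and self_mem_nhdsWithin).exists
  have ht0' : (0 : ℝ) < t := ht0
  refine ⟨t, ht0', fun i => ?_, ht⟩
  by_cases hi : i ∈ facetsAt u c v
  · have h1 := apply_eq_of_mem_facetsAt hi
    have h2 := mul_nonpos_of_nonneg_of_nonpos ht0'.le (hz i hi)
    simp only [map_add, map_smul, smul_eq_mul]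
    linarith
  · exact (ht i hi).le

/-- The functionals that are tight at a vertex separate points. -/
theorem eq_zero_of_facetsAt (hv : v ∈ vertices u c) (hz : ∀ i ∈ facetsAt u c v, u i z = 0) :
    z = 0 := by
  have hvP := mem_polyhedron_of_mem_vertices hv
  obtain ⟨t, ht, hmem, hlt⟩ := exists_step_mem hvP fun i hi => (hz i hi).le
  -- A small step along `z` changes no tight constraint, and a vertex is determined by its tight
  -- facets.
  have h : facetsAt u c v = facetsAt u c (v + t • z) := by
    ext i
    constructor
    · intro hi
      rw [mem_facetsAt_iff hmem]
      simp [hz i hi, apply_eq_of_mem_facetsAt hi]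
    · intro hi
      by_contra hi'
      exact (hlt i hi').ne (apply_eq_of_mem_facetsAt hi)
  have := eq_of_facetsAt_eq (mem_vertices.1 hv) hmem h
  simpa [ht.ne'] using this

theorem eq_of_forall_facetsAt (hv : v ∈ vertices u c) (h : ∀ i ∈ facetsAt u c v, u i x = c i) :
    x = v := by
  refine sub_eq_zero.1 (eq_zero_of_facetsAt hv fun i hi => ?_)
  rw [map_sub, h i hi, apply_eq_of_mem_facetsAt hi, sub_self]

/-- At a vertex on exactly `n` facets the tight functionals have a dual family. -/
theorem exists_dual_family (hv : v ∈ vertices u c) (hcard : (facetsAt u c v).card = n) :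
    ∃ β : Fin d → EuclideanSpace ℝ (Fin n), ∀ i ∈ facetsAt u c v, ∀ j ∈ facetsAt u c v,
      u i (β j) = if i = j then 1 else 0 := by
  -- Joint evaluation is injective at a vertex, and simplicity equates the dimensions; the dual
  -- family consists of preimages of unit vectors.
  let L : EuclideanSpace ℝ (Fin n) →ₗ[ℝ] (facetsAt u c v → ℝ) :=
    LinearMap.pi fun i => (u i : EuclideanSpace ℝ (Fin n) →ₗ[ℝ] ℝ)
  have hinj : Function.Injective L := by
    rw [injective_iff_map_eq_zero]
    intro z hz
    exact eq_zero_of_facetsAt hv fun i hi => congrFun hz ⟨i, hi⟩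
  have hsurj : Function.Surjective L := by
    refine (LinearMap.injective_iff_surjective_of_finrank_eq_finrank ?_).1 hinj
    simp [hcard]
  choose g hg using hsurj
  refine ⟨fun j => g fun i => if (i : Fin d) = j then 1 else 0, fun i hi j _ => ?_⟩
  exact congrFun (hg fun i => if (i : Fin d) = j then 1 else 0) ⟨i, hi⟩

/-- An edge vector at a simple vertex is a negative multiple of a vector of the dual family. -/
theorem IsEdgeVector.apply (hv : v ∈ vertices u c) (hcard : (facetsAt u c v).card = n)
    {i : Fin d} (hi : i ∈ facetsAt u c v) {a : EuclideanSpace ℝ (Fin n)}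
    (ha : IsEdgeVector u c v i a) :
    u i a < 0 ∧ ∀ j ∈ facetsAt u c v, j ≠ i → u j a = 0 := by
  obtain ⟨ha0, e, ⟨⟨hexp, hne⟩, hdim⟩, hve, hei, t, ht, hta⟩ := ha
  have hvP := mem_polyhedron_of_mem_vertices hv
  have haspan : a ∈ vectorSpan ℝ e := by
    have h := (vectorSpan ℝ e).smul_mem t⁻¹ (vsub_mem_vectorSpan ℝ hta hve)
    simpa [smul_smul, inv_mul_cancel₀ ht.ne'] using h
  have hmul : ∀ y ∈ e, ∃ r : ℝ, r • a = y - v := by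
    intro y hy
    have h := (finrank_eq_one_iff_of_nonzero' (⟨a, haspan⟩ : vectorSpan ℝ e)
      (by simpa [Subtype.ext_iff] using ha0)).1 hdim ⟨y - v, vsub_mem_vectorSpan ℝ hy hve⟩
    obtain ⟨r, hr⟩ := h
    exact ⟨r, congrArg Subtype.val hr⟩
  have hle : ∀ j ∈ facetsAt u c v, u j a ≤ 0 := by
    intro j hj
    have h := hexp.subset hta j
    simp only [map_add, map_smul, smul_eq_mul, apply_eq_of_mem_facetsAt hj] at h
    by_contra! hlt
    linarith [mul_pos ht hlt]
  have hneg : u i a < 0 := by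
    refine lt_of_le_of_ne (hle i hi) fun h0 => hei fun y hy => ⟨hexp.subset hy, ?_⟩
    obtain ⟨r, hr⟩ := hmul y hy
    have h := congrArg (u i) hr
    rw [map_smul, h0, smul_zero, map_sub, apply_eq_of_mem_facetsAt hi] at h
    exact (sub_eq_zero.1 h.symm)
  refine ⟨hneg, ?_⟩
  obtain ⟨β, hβ⟩ := exists_dual_family hv hcard
  -- Let `l` expose the edge. The directions `-β k` enter the polytope, so `l (β k) ≥ 0`, while `l a
  -- = 0`. Expanding `a` in the `β k` gives a vanishing sum of terms of one sign, and `u i a < 0`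
  -- forces `l (β i) = 0`.
  obtain ⟨l, hl⟩ := hexp hne
  have hmem : ∀ k ∈ facetsAt u c v, ∃ s : ℝ, 0 < s ∧ v + s • -β k ∈ polyhedron u c := by
    intro k hk
    obtain ⟨s, hs, hmem, -⟩ := exists_step_mem (z := -β k) hvP fun j hj => by
      rw [map_neg, hβ j hj k hk]
      split_ifs <;> norm_num
    exact ⟨s, hs, hmem⟩
  have hvl : ∀ y ∈ polyhedron u c, l y ≤ l v := by
    rw [hl] at hve
    exact hve.2
  have hlβ : ∀ k ∈ facetsAt u c v, 0 ≤ l (β k) := by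
    intro k hk
    obtain ⟨s, hs, hmem⟩ := hmem k hk
    have h := hvl _ hmem
    simp only [map_add, map_smul, map_neg, smul_eq_mul] at h
    by_contra! hlt
    nlinarith [mul_pos hs (neg_pos.2 hlt)]
  have hla : l a = 0 := by
    rw [hl] at hta
    have h1 := hta.2 v hvP
    have h2 := hvl _ hta.1
    simp only [map_add, map_smul, smul_eq_mul] at h1 h2
    have h3 : t * l a = 0 := by linarith
    exact (mul_eq_zero.1 h3).resolve_left ht.ne'
  have hdec : a = ∑ k ∈ facetsAt u c v, u k a • β k := by
    refine sub_eq_zero.1 (eq_zero_of_facetsAt hv fun j hj => ?_)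
    rw [map_sub, map_sum, Finset.sum_congr rfl (g := fun k => if j = k then u j a else 0)]
    · simp [hj]
    · intro k hk
      rw [map_smul, hβ j hj k hk]
      split_ifs with h
      · simp [h]
      · simp
  have hsum : ∑ k ∈ facetsAt u c v, -(u k a * l (β k)) = 0 := by
    have h := congrArg l hdec
    rw [hla, map_sum] at h
    simp only [map_smul, smul_eq_mul] at h
    rw [Finset.sum_neg_distrib, ← h, neg_zero]
  have hlβi : l (β i) = 0 := by
    have h := (Finset.sum_eq_zero_iff_of_nonneg fun k hk => by
      have := mul_nonneg (neg_nonneg.2 (hle k hk)) (hlβ k hk)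
      linarith).1 hsum i hi
    rw [neg_eq_zero] at h
    exact (mul_eq_zero.1 h).resolve_left hneg.ne
  obtain ⟨s, hs, hsmem⟩ := hmem i hi
  -- The direction `-β i` stays in the edge, hence is a multiple of `a`; every other tight
  -- functional kills it.
  have hse : v + s • -β i ∈ e := by
    rw [hl]
    refine ⟨hsmem, fun y hy => ?_⟩
    simpa [hlβi] using hvl y hy
  obtain ⟨r, hr⟩ := hmul _ hse
  intro j hj hji
  have h1 := congrArg (u i) hr
  have h2 := congrArg (u j) hr
  simp only [map_smul, map_sub, map_add, map_neg, hβ i hi i hi, hβ j hj i hi, hji, if_true,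
    if_false, smul_eq_mul] at h1 h2
  have hr0 : r ≠ 0 := by
    rintro rfl
    linarith
  have h3 : r * u j a = 0 := by linarith
  exact (mul_eq_zero.1 h3).resolve_left hr0

/-- Each point of a compact polyhedron shares its tight facets with some vertex. -/
theorem exists_vertex (hc : IsCompact (polyhedron u c)) (hx : x ∈ polyhedron u c)
    {J : Finset (Fin d)} (hJ : ∀ j ∈ J, u j x = c j) :
    ∃ v ∈ vertices u c, J ⊆ facetsAt u c v := by
  let F : Set (EuclideanSpace ℝ (Fin n)) := {y | y ∈ polyhedron u c ∧ ∀ j ∈ J, u j y = c j}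
  have hexp : IsExposed ℝ (polyhedron u c) F := by
    refine fun _ => ⟨∑ j ∈ J, u j, ?_⟩
    ext y
    constructor
    · rintro ⟨hy, hyJ⟩
      refine ⟨hy, fun z hz => ?_⟩
      simp only [sum_apply]
      exact Finset.sum_le_sum fun j hj => (hz j).trans (hyJ j hj).ge
    · rintro ⟨hy, hyx⟩
      refine ⟨hy, ?_⟩
      have h1 := hyx x hx
      simp only [sum_apply] at h1
      rw [Finset.sum_congr rfl hJ] at h1
      exact (Finset.sum_eq_sum_iff_of_le fun i _ => hy i).1
        (le_antisymm (Finset.sum_le_sum fun i _ => hy i) h1)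
  -- A nonempty compact face has an extreme point, which is extreme in the whole polytope.
  obtain ⟨v, hv⟩ := (hexp.isCompact hc).extremePoints_nonempty ⟨x, hx, hJ⟩
  have hvF : v ∈ F := hv.1
  refine ⟨v, mem_vertices.2 (hexp.isExtreme.extremePoints_subset_extremePoints hv), ?_⟩
  intro j hj
  exact (mem_facetsAt_iff hvF.1).2 (hvF.2 j hj)

end Polytope

/-! ### Combinatorics of the defect -/

section Defect

variable {κ ι : Type*} [Fintype ι] [DecidableEq ι]

/-- The difference of the two sides of the polar decomposition of the face with index set `J`,
for facet weights `h` and flipping indicators `f`. -/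
def defect (V : Finset κ) (I : κ → Finset ι) (f : κ → ι → ℝ) (J : Finset ι) (h : ι → ℝ) : ℝ :=
  ∑ v ∈ V with J ⊆ I v, ∏ i ∈ I v \ J, (h i - f v i) - ∏ i ∈ Jᶜ, h i

/-- The defect is affine in each facet weight, the slope being the defect of a smaller face. -/
theorem defect_update (V : Finset κ) (I : κ → Finset ι) (f : κ → ι → ℝ) {J : Finset ι} {i : ι}
    (hi : i ∉ J) (h : ι → ℝ) (s : ℝ) :
    defect V I f J (Function.update h i s) =
      defect V I f J h + (s - h i) * defect V I f (insert i J) h := by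
  have hcompl : Jᶜ = insert i (insert i J)ᶜ := by
    ext j
    by_cases hj : j = i <;> simp [hj, hi]
  have hni : i ∉ (insert i J)ᶜ := by simp
  have hupd : ∀ j, j ≠ i → Function.update h i s j = h j := fun j hj =>
    Function.update_of_ne hj s h
  have h1 : ∏ j ∈ Jᶜ, Function.update h i s j = s * ∏ j ∈ (insert i J)ᶜ, h j := by
    rw [hcompl, Finset.prod_insert hni, Function.update_self]
    congr 1
    exact Finset.prod_congr rfl fun j hj => hupd j fun e => hni (e ▸ hj)
  have h2 : ∏ j ∈ Jᶜ, h j = h i * ∏ j ∈ (insert i J)ᶜ, h j := by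
    rw [hcompl, Finset.prod_insert hni]
  -- Only vertices on facet `i` see the change, each through the single factor `h i - f v i`, so the
  -- flip term cancels in the difference.
  have h3 : ∑ v ∈ V with J ⊆ I v, ∏ j ∈ I v \ J, (Function.update h i s j - f v j) =
      ∑ v ∈ V with J ⊆ I v, ∏ j ∈ I v \ J, (h j - f v j) +
        (s - h i) * ∑ v ∈ V with insert i J ⊆ I v, ∏ j ∈ I v \ insert i J, (h j - f v j) := by
    have hfilter : (V.filter fun v => insert i J ⊆ I v) =
        (V.filter fun v => J ⊆ I v).filter fun v => i ∈ I v := by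
      ext v
      simp only [Finset.mem_filter, Finset.insert_subset_iff]
      tauto
    rw [hfilter, Finset.sum_filter (s := V.filter fun v => J ⊆ I v), Finset.mul_sum,
      ← Finset.sum_add_distrib]
    refine Finset.sum_congr rfl fun v _ => ?_
    by_cases hv : i ∈ I v
    · have hset : I v \ J = insert i (I v \ insert i J) := by
        ext j
        by_cases hj : j = i <;> simp [hj, hi, hv]
      have hni' : i ∉ I v \ insert i J := by simp
      rw [if_pos hv, hset, Finset.prod_insert hni', Finset.prod_insert hni', Function.update_self,
        Finset.prod_congr rfl fun j hj => by rw [hupd j fun e => hni' (e ▸ hj)]]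
      ring
    · rw [if_neg hv, mul_zero, add_zero]
      refine Finset.prod_congr rfl fun j hj => ?_
      rw [hupd j]
      rintro rfl
      exact hv (Finset.mem_sdiff.1 hj).1
  rw [defect, defect, defect, h1, h2, h3]
  ring

theorem defect_congr (V : Finset κ) (I : κ → Finset ι) (f : κ → ι → ℝ) {J : Finset ι}
    {h h' : ι → ℝ} (hh : ∀ i, i ∉ J → h i = h' i) : defect V I f J h = defect V I f J h' := by
  rw [defect, defect]
  congr 1
  · refine Finset.sum_congr rfl fun v _ => Finset.prod_congr rfl fun i hi => ?_
    rw [hh i (Finset.mem_sdiff.1 hi).2]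
  · exact Finset.prod_congr rfl fun i hi => hh i (Finset.mem_compl.1 hi)

end Defect

/-! ### Vanishing of the defect -/

section Polytope

variable {n d : ℕ} {u : Fin d → StrongDual ℝ (EuclideanSpace ℝ (Fin n))} {c : Fin d → ℝ}
  {v x : EuclideanSpace ℝ (Fin n)}

/-- The expansion of a point with respect to the edge vectors at a vertex. -/
theorem eq_add_sum_edge (hv : v ∈ vertices u c) {a : Fin d → EuclideanSpace ℝ (Fin n)}
    (ha : ∀ i ∈ facetsAt u c v, u i (a i) ≠ 0 ∧ ∀ j ∈ facetsAt u c v, j ≠ i → u j (a i) = 0)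
    (x : EuclideanSpace ℝ (Fin n)) :
    x = v + ∑ i ∈ facetsAt u c v, ((u i x - c i) / u i (a i)) • a i := by
  refine sub_eq_zero.1 (eq_zero_of_facetsAt hv fun j hj => ?_)
  rw [map_sub, map_add, map_sum, Finset.sum_eq_single_of_mem j hj]
  · rw [map_smul, smul_eq_mul, div_mul_cancel₀ _ (ha j hj).1, apply_eq_of_mem_facetsAt hj]
    ring
  · intro i hi hij
    rw [map_smul, (ha i hi).2 j hj hij.symm, smul_zero]

/-- The facet weights `h` are those of the point `x`, with arbitrary values at the facet
hyperplanes through `x`. -/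
def IsWeightAt (u : Fin d → StrongDual ℝ (EuclideanSpace ℝ (Fin n))) (c : Fin d → ℝ)
    (x : EuclideanSpace ℝ (Fin n)) (h : Fin d → ℝ) : Prop :=
  ∀ i, (u i x < c i → h i = 1) ∧ (c i < u i x → h i = 0)

/-- The indicator of the edge vectors that are flipped. -/
def flipInd (ξ : StrongDual ℝ (EuclideanSpace ℝ (Fin n)))
    (α : EuclideanSpace ℝ (Fin n) → Fin d → EuclideanSpace ℝ (Fin n))
    (v : EuclideanSpace ℝ (Fin n)) (i : Fin d) : ℝ :=
  if 0 < ξ (α v i) then 1 else 0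

/-- The weights of `x` that are `1` on the facet hyperplanes through `x`. -/
def closedWeight (u : Fin d → StrongDual ℝ (EuclideanSpace ℝ (Fin n))) (c : Fin d → ℝ)
    (x : EuclideanSpace ℝ (Fin n)) (i : Fin d) : ℝ :=
  if u i x ≤ c i then 1 else 0

theorem isWeightAt_closedWeight (x : EuclideanSpace ℝ (Fin n)) :
    IsWeightAt u c x (closedWeight u c x) := fun _ =>
  ⟨fun h => if_pos h.le, fun h => if_neg h.not_ge⟩

/-- Weights of points close to `x` are weights of `x`. -/
theorem eventually_isWeightAt (x : EuclideanSpace ℝ (Fin n)) :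
    ∀ᶠ y in nhds x, ∀ h, IsWeightAt u c y h → IsWeightAt u c x h := by
  have h1 : ∀ᶠ y in nhds x, ∀ i, (u i x < c i → u i y < c i) ∧ (c i < u i x → c i < u i y) := by
    refine Filter.eventually_all.2 fun i => Filter.Eventually.and ?_ ?_
    · by_cases hi : u i x < c i
      · exact ((u i).continuous.continuousAt.eventually_lt_const hi).mono fun y hy _ => hy
      · exact Filter.Eventually.of_forall fun y h => absurd h hi
    · by_cases hi : c i < u i x
      · exact ((u i).continuous.continuousAt.eventually_const_lt hi).mono fun y hy _ => hy
      · exact Filter.Eventually.of_forall fun y h => absurd h hi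
  filter_upwards [h1] with y hy h hw i
  exact ⟨fun hi => (hw i).1 ((hy i).1 hi), fun hi => (hw i).2 ((hy i).2 hi)⟩

/-- If the defects of the facets of a face vanish, the defect of the face does not depend on the
choice of weights at a point. -/
theorem IsWeightAt.defect_eq {κ : Type*} {V : Finset κ} {I : κ → Finset (Fin d)}
    {f : κ → Fin d → ℝ} {J : Finset (Fin d)}
    (IH : ∀ i, i ∉ J → u i x = c i → ∀ h, IsWeightAt u c x h → defect V I f (insert i J) h = 0)
    {h h' : Fin d → ℝ} (hh : IsWeightAt u c x h) (hh' : IsWeightAt u c x h') :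
    defect V I f J h = defect V I f J h' := by
  -- Pass from `h` to `h'` one coordinate at a time. A coordinate off its hyperplane does not
  -- change, and one on it multiplies a zero slope.
  have key : ∀ A : Finset (Fin d), defect V I f J (A.piecewise h' h) = defect V I f J h := by
    intro A
    induction A using Finset.induction_on with
    | empty => simp
    | insert i A hiA ih =>
      rw [Finset.piecewise_insert]
      by_cases hi : i ∈ J
      · rw [← ih]
        refine defect_congr V I f fun j hj => Function.update_of_ne ?_ _ _
        rintro rfl
        exact hj hi
      · rw [defect_update V I f hi, ih, Finset.piecewise_eq_of_notMem _ _ _ hiA]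
        rcases lt_trichotomy (u i x) (c i) with hlt | heq | hgt
        · rw [(hh i).1 hlt, (hh' i).1 hlt]
          ring
        · rw [IH i hi heq, mul_zero, add_zero]
          intro j
          by_cases hj : j ∈ A
          · simpa [hj] using hh' j
          · simpa [hj] using hh j
        · rw [(hh i).2 hgt, (hh' i).2 hgt]
          ring
  rw [← key Finset.univ, Finset.piecewise_univ]

variable {α : EuclideanSpace ℝ (Fin n) → Fin d → EuclideanSpace ℝ (Fin n)}
  {ξ : StrongDual ℝ (EuclideanSpace ℝ (Fin n))}

/-- A vertex with a nonvanishing contribution at `x` lies at least as high as `x`. -/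
theorem apply_le_of_prod_ne_zero (hv : v ∈ vertices u c)
    (hα : ∀ i ∈ facetsAt u c v,
      u i (α v i) < 0 ∧ ∀ j ∈ facetsAt u c v, j ≠ i → u j (α v i) = 0)
    {J : Finset (Fin d)} (hJ : ∀ j ∈ J, u j x = c j)
    (hne : ∏ i ∈ facetsAt u c v \ J, (closedWeight u c x i - flipInd ξ α v i) ≠ 0) :
    ξ x ≤ ξ v := by
  have hx := congrArg ξ
    (eq_add_sum_edge hv (fun i hi => ⟨(hα i hi).1.ne, (hα i hi).2⟩) x)
  rw [hx, map_add, map_sum, add_le_iff_nonpos_right]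
  -- A nonzero factor forces weight `0` where the edge vector is flipped and weight `1` elsewhere.
  -- As `u i (α v i) < 0`, the coefficient is then nonpositive or nonnegative respectively, opposite
  -- to the sign of `ξ (α v i)`.
  refine Finset.sum_nonpos fun i hi => ?_
  rw [map_smul, smul_eq_mul]
  by_cases hiJ : i ∈ J
  · simp [hJ i hiJ]
  · have hi0 := Finset.prod_ne_zero_iff.1 hne i (Finset.mem_sdiff.2 ⟨hi, hiJ⟩)
    by_cases hξ : 0 < ξ (α v i)
    · have hgt : c i < u i x := by
        by_contra! hle
        simp [closedWeight, flipInd, hξ, hle] at hi0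
      exact mul_nonpos_of_nonpos_of_nonneg
        (div_nonpos_of_nonneg_of_nonpos (by linarith) (hα i hi).1.le) hξ.le
    · have hle : u i x ≤ c i := by
        by_contra! hgt
        simp [closedWeight, flipInd, hξ, hgt.not_ge] at hi0
      exact mul_nonpos_of_nonneg_of_nonpos
        (div_nonneg_of_nonpos (by linarith) (hα i hi).1.le) (not_lt.1 hξ)

/-- The polar decomposition of the faces of a simple polytope, for arbitrary facet weights on the
facet hyperplanes. -/
theorem defect_eq_zero (hc : IsCompact (polyhedron u c))
    (hα : ∀ v ∈ vertices u c, ∀ i ∈ facetsAt u c v,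
      u i (α v i) < 0 ∧ ∀ j ∈ facetsAt u c v, j ≠ i → u j (α v i) = 0)
    (hξ : ∀ v ∈ vertices u c, ∀ i ∈ facetsAt u c v, ξ (α v i) ≠ 0)
    (J : Finset (Fin d)) (hJ : ∀ j ∈ J, u j x = c j) (h : Fin d → ℝ) (hh : IsWeightAt u c x h) :
    defect (vertices u c) (facetsAt u c) (flipInd ξ α) J h = 0 := by
  -- The point is generalized because the hypothesis is needed all along a line through `x`.
  induction hk : Jᶜ.card using Nat.strong_induction_on generalizing J x h with
  | _ k IH =>
  subst hk
  by_cases hex : ∃ v ∈ vertices u c, J ⊆ facetsAt u c v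
  swap
  · push Not at hex
    have hx : x ∉ polyhedron u c := fun hx => by
      obtain ⟨v, hv, hJv⟩ := exists_vertex hc hx hJ
      exact hex v hv hJv
    obtain ⟨i, hi⟩ : ∃ i, c i < u i x := by
      by_contra! hle
      exact hx hle
    have hiJ : i ∈ Jᶜ := Finset.mem_compl.2 fun hiJ => hi.ne' (hJ i hiJ)
    rw [defect, Finset.filter_false_of_mem hex, Finset.sum_empty,
      Finset.prod_eq_zero hiJ ((hh i).2 hi), sub_zero]
  obtain ⟨v, hv, hJv⟩ := hex
  -- If the face is a single vertex there is no direction to move in; then `x = v` and both sides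
  -- are `1`.
  by_cases hvJ : facetsAt u c v ⊆ J
  · obtain rfl : J = facetsAt u c v := Finset.Subset.antisymm hJv hvJ
    obtain rfl : x = v := eq_of_forall_facetsAt hv hJ
    have hfilter : ((vertices u c).filter fun w => facetsAt u c x ⊆ facetsAt u c w) = {x} := by
      ext w
      simp only [Finset.mem_filter, Finset.mem_singleton]
      constructor
      · rintro ⟨hw, hsub⟩
        exact (eq_of_forall_facetsAt hv fun i hi => apply_eq_of_mem_facetsAt (hsub hi))
      · rintro rfl
        exact ⟨hv, subset_rfl⟩
    rw [defect, hfilter, Finset.sum_singleton, Finset.sdiff_self, Finset.prod_empty,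
      Finset.prod_eq_one, sub_self]
    intro i hi
    rw [Finset.mem_compl, mem_facetsAt_iff (mem_polyhedron_of_mem_vertices hv)] at hi
    exact (hh i).1 (lt_of_le_of_ne (mem_polyhedron_of_mem_vertices hv i) hi)
  obtain ⟨i, hi, hiJ⟩ := Finset.not_subset.1 hvJ
  -- The edge at `v` leaving facet `i` lies in all facets of `J`; up to sign it is a direction of
  -- increasing `ξ`.
  obtain ⟨w, hwJ, hw⟩ : ∃ w : EuclideanSpace ℝ (Fin n), (∀ j ∈ J, u j w = 0) ∧ 0 < ξ w := by
    have h0 : ∀ j ∈ J, u j (α v i) = 0 := fun j hj =>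
      (hα v hv i hi).2 j (hJv hj) fun e => hiJ (e ▸ hj)
    rcases (hξ v hv i hi).lt_or_gt with hlt | hgt
    · exact ⟨-α v i, fun j hj => by simp [h0 j hj], by simpa using hlt⟩
    · exact ⟨α v i, h0, hgt⟩
  have hline : ∀ t : ℝ, ∀ j ∈ J, u j (x + t • w) = c j := fun t j hj => by
    simp [hwJ j hj, hJ j hj]
  have hind : ∀ (t : ℝ) (h h' : Fin d → ℝ), IsWeightAt u c (x + t • w) h →
      IsWeightAt u c (x + t • w) h' →
      defect (vertices u c) (facetsAt u c) (flipInd ξ α) J h =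
        defect (vertices u c) (facetsAt u c) (flipInd ξ α) J h' := by
    intro t h h' hh hh'
    refine IsWeightAt.defect_eq (fun j hj hjx g hg => ?_) hh hh'
    refine IH _ ?_ (insert j J) ?_ g hg rfl
    · apply Finset.card_lt_card
      rw [Finset.compl_ssubset_compl]
      exact Finset.ssubset_insert hj
    · intro k hk
      rcases Finset.mem_insert.1 hk with rfl | hk
      · exact hjx
      · exact hline t k hk
  let g : ℝ → ℝ := fun t =>
    defect (vertices u c) (facetsAt u c) (flipInd ξ α) J (closedWeight u c (x + t • w))
  -- Weights at a nearby parameter `s` are also weights at `t`, where the choice is immaterial; so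
  -- crossing a hyperplane causes no jump.
  have hg : IsLocallyConstant g := by
    rw [IsLocallyConstant.iff_eventually_eq]
    intro t
    have hcont : Continuous fun s : ℝ => x + s • w := by fun_prop
    filter_upwards [hcont.continuousAt.eventually (eventually_isWeightAt (u := u) (c := c)
      (x + t • w))] with s hs
    exact hind t _ _ (hs _ (isWeightAt_closedWeight _)) (isWeightAt_closedWeight _)
  obtain ⟨R, hR⟩ : ∃ R : ℝ, ∀ y ∈ polyhedron u c, ξ y ≤ R := by
    obtain ⟨R, hR⟩ := (hc.image ξ.continuous).bddAbove
    exact ⟨R, fun y hy => hR ⟨y, hy, rfl⟩⟩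
  obtain ⟨T, hT⟩ : ∃ T : ℝ, R < ξ (x + T • w) := by
    refine ⟨(R - ξ x + 1) / ξ w, ?_⟩
    rw [map_add, map_smul, smul_eq_mul, div_mul_cancel₀ _ hw.ne']
    linarith
  have hgT : g T = 0 := by
    have h1 : ∀ v ∈ (vertices u c).filter (fun v => J ⊆ facetsAt u c v),
        ∏ i ∈ facetsAt u c v \ J,
          (closedWeight u c (x + T • w) i - flipInd ξ α v i) = 0 := by
      intro v hv
      have hv := (Finset.mem_filter.1 hv).1
      by_contra hne
      exact ((hR v (mem_polyhedron_of_mem_vertices hv)).trans_lt hT).not_ge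
        (apply_le_of_prod_ne_zero hv (hα v hv) (hline T) hne)
    obtain ⟨i, hi⟩ : ∃ i, c i < u i (x + T • w) := by
      by_contra! hle
      exact hT.not_ge (hR _ hle)
    have hiJ : i ∈ Jᶜ := Finset.mem_compl.2 fun hiJ => hi.ne' (hline T i hiJ)
    simp only [g]
    rw [defect, Finset.sum_eq_zero h1,
      Finset.prod_eq_zero hiJ ((isWeightAt_closedWeight _ i).2 hi), sub_zero]
  have h0 := hg.apply_eq_of_preconnectedSpace 0 T
  rw [hgT] at h0
  rw [← h0]
  refine hind 0 _ _ (by simpa using hh) (isWeightAt_closedWeight _)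

/-! ### Cones and polytope as products of weights -/

theorem polarize_eq (ξ : StrongDual ℝ (EuclideanSpace ℝ (Fin n)))
    (a : EuclideanSpace ℝ (Fin n)) :
    polarize ξ a = (if 0 < ξ a then (-1 : ℝ) else 1) • a := by
  rw [polarize]
  split_ifs <;> simp

/-- The weighted characteristic function of a simplicial cone at a vertex. -/
theorem weightedIndicator_coneAt (hv : v ∈ vertices u c)
    {a : Fin d → EuclideanSpace ℝ (Fin n)}
    (ha : ∀ i ∈ facetsAt u c v, u i (a i) ≠ 0 ∧ ∀ j ∈ facetsAt u c v, j ≠ i → u j (a i) = 0)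
    (x : EuclideanSpace ℝ (Fin n)) :
    weightedIndicator (coneAt v (facetsAt u c v) a) x =
      ∏ i ∈ facetsAt u c v, halfStep ((u i x - c i) / u i (a i)) := by
  -- Normalized so that the slack `b i - w i y` is the coordinate of `y - v` along `a i`; the dual
  -- family is then `-a i`.
  let w : facetsAt u c v → StrongDual ℝ (EuclideanSpace ℝ (Fin n)) :=
    fun i => -(u i (a i))⁻¹ • u i
  let b : facetsAt u c v → ℝ := fun i => -(u i (a i))⁻¹ * c i
  have hwb : ∀ i y, b i - w i y = (u i y - c i) / u i (a i) := by
    intro i y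
    simp only [b, w, smul_apply, smul_eq_mul]
    ring
  have hcone : coneAt v (facetsAt u c v) a = {y | ∀ i, w i y ≤ b i} := by
    ext y
    constructor
    · rintro ⟨r, hr, rfl⟩ i
      rw [← sub_nonneg, hwb, map_add, map_sum, Finset.sum_eq_single_of_mem (i : Fin d) i.2,
        apply_eq_of_mem_facetsAt i.2, map_smul, smul_eq_mul, add_sub_cancel_left,
        mul_div_cancel_right₀ _ (ha i i.2).1]
      · exact hr i
      · intro j hj hji
        rw [map_smul, (ha j hj).2 i i.2 hji.symm, smul_zero]
    · intro hy
      refine ⟨fun i => if i ∈ facetsAt u c v then (u i y - c i) / u i (a i) else 0, ?_, ?_⟩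
      · intro i
        dsimp only
        split_ifs with hi
        · have h := hwb ⟨i, hi⟩ y
          dsimp only at h
          rw [← h]
          exact sub_nonneg.2 (hy ⟨i, hi⟩)
        · exact le_rfl
      · rw [Finset.sum_congr rfl (g := fun i => ((u i y - c i) / u i (a i)) • a i)]
        · exact eq_add_sum_edge hv ha y
        · intro i hi
          simp only [if_pos hi]
  rw [hcone, weightedIndicator_eq_prod w b x, Finset.prod_congr rfl fun i _ => by rw [hwb i x]]
  · exact Finset.prod_coe_sort (facetsAt u c v) fun i => halfStep ((u i x - c i) / u i (a i))
  · intro _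
    refine ⟨fun j => -a j, fun i j _ _ => ?_⟩
    simp only [w, smul_apply, smul_eq_mul, map_neg, neg_mul, neg_neg]
    split_ifs with hij
    · subst hij
      exact inv_mul_cancel₀ (ha i i.2).1
    · rw [(ha j j.2).2 i i.2 fun e => hij (Subtype.ext e), mul_zero]

/-- Flipping an edge vector replaces the half-space of its facet by the opposite one; the sign turns
`1 - h i` into `h i - 1`. -/
theorem weightedIndicator_polarizedCone (hv : v ∈ vertices u c)
    (hα : ∀ i ∈ facetsAt u c v,
      u i (α v i) < 0 ∧ ∀ j ∈ facetsAt u c v, j ≠ i → u j (α v i) = 0)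
    (x : EuclideanSpace ℝ (Fin n)) :
    (-1) ^ numFlipped u c ξ v (α v) * weightedIndicator (polarizedCone u c ξ v (α v)) x =
      ∏ i ∈ facetsAt u c v, (halfStep (c i - u i x) - flipInd ξ α v i) := by
  rw [polarizedCone, weightedIndicator_coneAt hv]
  · rw [numFlipped, ← Finset.prod_const, Finset.prod_filter, ← Finset.prod_mul_distrib]
    refine Finset.prod_congr rfl fun i hi => ?_
    have hpos : 0 < (-u i (α v i))⁻¹ := inv_pos.2 (neg_pos.2 (hα i hi).1)
    have hs : halfStep ((u i x - c i) / u i (α v i)) = halfStep (c i - u i x) := by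
      rw [← halfStep_mul_of_pos hpos (c i - u i x)]
      congr 1
      rw [inv_neg]
      ring
    by_cases hξ : 0 < ξ (α v i)
    · simp only [polarize, flipInd, hξ, if_true, map_neg, div_neg]
      rw [halfStep_neg, hs]
      ring
    · simp only [polarize, flipInd, hξ, if_false]
      rw [hs]
      ring
  · intro i hi
    simp only [polarize_eq, map_smul, smul_eq_mul]
    refine ⟨mul_ne_zero (by split_ifs <;> norm_num) (hα i hi).1.ne, fun j hj hji => ?_⟩
    rw [(hα i hi).2 j hj hji, mul_zero]

/-- The facets tight at a point of the polytope share a vertex, where simplicity makes their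
functionals independent. -/
theorem weightedIndicator_polyhedron (hc : IsCompact (polyhedron u c))
    (hcard : ∀ v ∈ vertices u c, (facetsAt u c v).card = n) (x : EuclideanSpace ℝ (Fin n)) :
    weightedIndicator (polyhedron u c) x = ∏ i, halfStep (c i - u i x) := by
  refine weightedIndicator_eq_prod u c x fun hx => ?_
  obtain ⟨v, hv, hJ⟩ := exists_vertex (J := Finset.univ.filter fun i => u i x = c i) hc hx
    fun j hj => (Finset.mem_filter.1 hj).2
  obtain ⟨β, hβ⟩ := exists_dual_family hv (hcard v hv)
  exact ⟨β, fun i j hi hj => hβ i (hJ (by simpa using hi)) j (hJ (by simpa using hj))⟩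

theorem isWeightAt_halfStep (x : EuclideanSpace ℝ (Fin n)) :
    IsWeightAt u c x fun i => halfStep (c i - u i x) := fun _ =>
  ⟨fun h => halfStep_of_pos (sub_pos.2 h), fun h => halfStep_of_neg (sub_neg.2 h)⟩

end Polytope

end PolarDecomposition

end

theorem proposition3p1 (n d : ℕ)
    (u : Fin d → StrongDual ℝ (EuclideanSpace ℝ (Fin n))) (c : Fin d → ℝ)
    (hΔ : PolarDecomposition.IsSimplePolytope u c)
    (α : EuclideanSpace ℝ (Fin n) → Fin d → EuclideanSpace ℝ (Fin n))
    (hα : ∀ v ∈ PolarDecomposition.vertices u c, ∀ i ∈ PolarDecomposition.facetsAt u c v,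
      PolarDecomposition.IsEdgeVector u c v i (α v i))
    (ξ : StrongDual ℝ (EuclideanSpace ℝ (Fin n)))
    (hξ : ∀ v ∈ PolarDecomposition.vertices u c, ∀ i ∈ PolarDecomposition.facetsAt u c v,
      ξ (α v i) ≠ 0)
    (x : EuclideanSpace ℝ (Fin n)) :
    PolarDecomposition.weightedIndicator (PolarDecomposition.polyhedron u c) x =
      ∑ v ∈ PolarDecomposition.vertices u c,
        (-1) ^ PolarDecomposition.numFlipped u c ξ v (α v) *
          PolarDecomposition.weightedIndicator
            (PolarDecomposition.polarizedCone u c ξ v (α v)) x := by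
  have hcard := hΔ.simple
  have hα' : ∀ v ∈ PolarDecomposition.vertices u c, ∀ i ∈ PolarDecomposition.facetsAt u c v,
      u i (α v i) < 0 ∧
        ∀ j ∈ PolarDecomposition.facetsAt u c v, j ≠ i → u j (α v i) = 0 :=
    fun v hv i hi => (hα v hv i hi).apply hv (hcard v hv) hi
  -- Empty `J` is the whole polytope; the value `1 / 2` is one admissible choice on the hyperplanes
  -- through `x`.
  have h := PolarDecomposition.defect_eq_zero hΔ.isCompact hα' hξ ∅ (by simp) _
    (PolarDecomposition.isWeightAt_halfStep x)
  rw [PolarDecomposition.defect, sub_eq_zero] at h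
  simp only [Finset.empty_subset, Finset.filter_true, Finset.sdiff_empty, Finset.compl_empty] at h
  rw [PolarDecomposition.weightedIndicator_polyhedron hΔ.isCompact hcard, ← h]
  exact Finset.sum_congr rfl fun v hv =>
    (PolarDecomposition.weightedIndicator_polarizedCone hv (hα' v hv) x).symm
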